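/- **Theorem.** Let $(q_k)_{k\ge 1}$ be a second Ostrogradsky sequence, i.e. a sequence of positive integers with $q_{k+1}\ge q_k(q_k+1)$ for all $k$. Let $\xi_1,\xi_2,\dots$ be independent random variables with values in $\{0,1\}$, $p_{ik}=\mathbb P(\xi_k=i)$ for $i\in\{0,1\}$, let $\mu=\mu_\xi$ be the distribution of $$\xi=\sum_{k=1}^\infty\frac{(-1)^{k+1}\xi_k}{q_k},$$ and let $S_\mu$ be its spectrum (topological support). Let $r=\sum_{k\ge1}\frac{(-1)^{k+1}}{q_k}$, and let $\nu_r$ be the uniform distribution on the set of all incomplete sums of this series, i.e. the distribution of $\sum_{k\ge1}\frac{(-1)^{k+1}\varepsilon_k}{q_k}$ with independent $\varepsilon_k$ taking the values $0$ and $1$ with probability $\frac12$ each. For $E\subset\mathbb R$ and $\alpha>0$ put $$H^\alpha(E,\nu_r)=\lim_{\varepsilon\to0}\ \inf\Big\{\sum_j \nu_r(E_j)^\alpha\Big\},$$ the infimum being over all at most countable coverings of $E$ by bounded closed intervals $E_j$ (one-point intervals allowed) with $\nu_r(E_j)\le\varepsilon$, and let $$\dim_H(E,\nu_r)=\inf\{\alpha>0: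 H^\alpha(E,\nu_r)=0\},\qquad \dim_H(\mu,\nu_r)=\inf\{\dim_H(E,\nu_r): E\subset\mathbb R\text{ Borel},\ \mu(E)=1\}$$ be the Hausdorff--Billingsley dimensions with respect to $\nu_r$ of the set $E$ and of the measure $\mu$. Let $h_k=-(p_{0k}\ln p_{0k}+p_{1k}\ln p_{1k})$ (with $0\ln 0=0$), $H_n=h_1+\dots+h_n$, and $N_k=\#\{j\le k: p_{0j}p_{1j}>0\}$. Then $$\dim_H(\mu,\nu_r)=\liminf_{n\to\infty}\frac{H_n}{n\ln 2}\qquad\text{and}\qquad \dim_H(S_\mu,\nu_r)=\liminf_{k\to\infty}\frac{N_k}{k}.$$ -/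

import Mathlib

open MeasureTheory ProbabilityTheory Filter
open scoped ENNReal

noncomputable section

namespace Ostrogradsky

/-- An infinite second Ostrogradsky sequence `q_1, q_2, …` of positive integers with
`q_{k+1} ≥ q_k (q_k + 1)`. Sequences are indexed from `0`: `q k` stands for `q_{k+1}`. -/
structure IsSecondOstrogradsky (q : ℕ → ℕ) : Prop where
  pos : ∀ k, 0 < q k
  growth : ∀ k, q k * (q k + 1) ≤ q (k + 1)

/-- The incomplete sum `∑_{k ≥ 1} (-1)^{k+1} e_k / q_k` of digits `e_k ∈ {0, 1}`
(with indices shifted by one, so the sign of the term of index `k` is `(-1)^k`). -/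
def incompleteSum (q : ℕ → ℕ) (e : ℕ → Fin 2) : ℝ :=
  ∑' k : ℕ, (-1 : ℝ) ^ k * ((e k : ℕ) : ℝ) / (q k : ℝ)

/-- The distribution `μ_ξ` of the random variable `ξ = ∑_{k ≥ 1} (-1)^{k+1} ξ_k / q_k`. -/
def seriesLaw {Ω : Type*} [MeasurableSpace Ω] (P : Measure Ω) (q : ℕ → ℕ)
    (ξ : ℕ → Ω → Fin 2) : Measure ℝ :=
  P.map fun ω => incompleteSum q fun k => ξ k ω

/-- The measure `ν_r`, uniformly distributed on the set of all incomplete sums: the distribution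
of `∑_{k ≥ 1} (-1)^{k+1} ε_k / q_k` for independent fair `ε_k ∈ {0, 1}`. -/
def uniformLaw (q : ℕ → ℕ) : Measure ℝ :=
  (Measure.infinitePi fun _ : ℕ => (PMF.uniformOfFintype (Fin 2)).toMeasure).map
    (incompleteSum q)

/-- The infimum of `∑_j ν(E_j)^α` over at most countable coverings `{E_j}` of `E` by members of
`Φ` with `ν(E_j) ≤ ε`. Unused indices `j` carry the empty set. -/
def billingsleyPre (ν : Measure ℝ) (Φ : Set (Set ℝ)) (α : ℝ) (ε : ℝ≥0∞) (E : Set ℝ) : ℝ≥0∞ :=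
  ⨅ (U : ℕ → Set ℝ) (_ : ∀ j, (U j = ∅ ∨ U j ∈ Φ) ∧ ν (U j) ≤ ε) (_ : E ⊆ ⋃ j, U j),
    ∑' j, ν (U j) ^ α

/-- The `ν`-`α`-Hausdorff–Billingsley measure of `E` with respect to the covering family `Φ`.
The limit as `ε → 0` is a supremum, as the quantity increases when `ε` decreases. -/
def billingsleyMeasure (ν : Measure ℝ) (Φ : Set (Set ℝ)) (α : ℝ) (E : Set ℝ) : ℝ≥0∞ :=
  ⨆ (ε : ℝ≥0∞) (_ : 0 < ε), billingsleyPre ν Φ α ε E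

/-- The family of all closed bounded intervals of the real line. -/
def closedIntervals : Set (Set ℝ) :=
  {I | ∃ a b : ℝ, a ≤ b ∧ I = Set.Icc a b}

/-- The Hausdorff–Billingsley dimension of `E` with respect to `ν` and the covering family `Φ`:
the infimum of the `α > 0` for which the Hausdorff–Billingsley measure vanishes. -/
def billingsleyDimWith (ν : Measure ℝ) (Φ : Set (Set ℝ)) (E : Set ℝ) : EReal :=
  ⨅ (α : ℝ) (_ : 0 < α) (_ : billingsleyMeasure ν Φ α E = 0), (α : EReal)

/-- The classical Hausdorff–Billingsley dimension `dim_H(E, ν)`: all closed intervals are allowed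
in the coverings. -/
def billingsleyDim (E : Set ℝ) (ν : Measure ℝ) : EReal :=
  billingsleyDimWith ν closedIntervals E

/-- The Hausdorff–Billingsley dimension `dim_H(μ, ν)` of the measure `μ` with respect to `ν`:
the infimum of `dim_H(E, ν)` over the Borel sets `E` with `μ(E) = 1`. -/
def billingsleyDimMeasure (μ ν : Measure ℝ) : EReal :=
  ⨅ (E : Set ℝ) (_ : MeasurableSet E) (_ : μ E = 1), billingsleyDim E ν

/-- `H_n = h_1 + ⋯ + h_n`, where `h_k = -(p_{0k} ln p_{0k} + p_{1k} ln p_{1k})` is the entropy of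
the `k`-th digit (`0 ln 0 = 0`). -/
def entropySum (p : Fin 2 → ℕ → ℝ) (n : ℕ) : ℝ :=
  ∑ k ∈ Finset.range n, -(p 0 k * Real.log (p 0 k) + p 1 k * Real.log (p 1 k))

open Classical in
/-- `N_k = #{j ≤ k : p_{0j} p_{1j} > 0}`. -/
def freeCount (p : Fin 2 → ℕ → ℝ) (k : ℕ) : ℕ :=
  ((Finset.range k).filter fun j => 0 < p 0 j * p 1 j).card

end Ostrogradsky

end

namespace Ostrogradsky

/-! ### Order structure of the set of incomplete sums -/

/-! Since `q (k + 1) ≥ 2 * q k`, each term `1 / q j` exceeds the whole tail after it. The first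
digit at which two sequences differ therefore decides the order of their sums, and cylinders of rank
`n` have separated hulls (`prefixWord_eq_of_mem_hull`), each of `ν_r`-mass `2⁻ⁿ`. An interval of
mass below `2⁻ⁿ` meets at most two of these cylinders (`card_prefixWord_le_two`), since with three
the middle hull would lie inside it. Up to a constant factor, interval covers can thus be replaced
by cylinder covers, and the question moves to the binary tree.

There Billingsley's principle applies. If almost every cylinder mass is eventually at most
`2^(-nα)`, no set of full measure has zero `α`-measure (`billingsleyMeasure_ne_zero`). If the points
lie in infinitely many hulls taken from families of at most `2^(nβ)` words, with `β < α`, the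
`α`-measure is zero (`billingsleyMeasure_eq_zero`).

For `μ`, the negative log-mass of a cylinder is a sum of independent terms with mean `H_n`, and a
strong law keeps it within `o(n)` of `H_n`. For the support, the relevant measure tosses fair coins
at the free digits, and there are at most `2^(N_n)` admissible words. -/

theorem IsSecondOstrogradsky.two_mul_le {q : ℕ → ℕ} (hq : IsSecondOstrogradsky q) (k : ℕ) :
    2 * q k ≤ q (k + 1) := by
  nlinarith [hq.growth k, hq.pos k]

theorem IsSecondOstrogradsky.two_pow_mul_le {q : ℕ → ℕ} (hq : IsSecondOstrogradsky q) (j i : ℕ) :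
    2 ^ i * q j ≤ q (j + i) := by
  induction i with
  | zero => simp
  | succ i ih =>
    have := hq.two_mul_le (j + i)
    rw [← add_assoc]
    rw [pow_succ]
    linarith

theorem IsSecondOstrogradsky.inv_add_le {q : ℕ → ℕ} (hq : IsSecondOstrogradsky q) (j i : ℕ) :
    1 / (q (j + i) : ℝ) ≤ 1 / (q j : ℝ) * (1 / 2) ^ i := by
  have hj : (0 : ℝ) < q j := by exact_mod_cast hq.pos j
  have h : (2 : ℝ) ^ i * q j ≤ q (j + i) := by exact_mod_cast hq.two_pow_mul_le j i
  calc 1 / (q (j + i) : ℝ) ≤ 1 / ((2 : ℝ) ^ i * q j) := by gcongr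
    _ = 1 / (q j : ℝ) * (1 / 2) ^ i := by
      rw [one_div_pow]; field_simp

theorem IsSecondOstrogradsky.summable {q : ℕ → ℕ} (hq : IsSecondOstrogradsky q) :
    Summable fun k => 1 / (q k : ℝ) := by
  refine Summable.of_nonneg_of_le (fun k => by positivity) (fun k => ?_)
    (summable_geometric_two.mul_left (1 / (q 0 : ℝ)))
  simpa using hq.inv_add_le 0 k

theorem IsSecondOstrogradsky.tsum_tail_lt {q : ℕ → ℕ} (hq : IsSecondOstrogradsky q) (j : ℕ) :
    ∑' i, 1 / (q (j + 1 + i) : ℝ) < 1 / q j := by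
  have hj : (0 : ℝ) < q j := by exact_mod_cast hq.pos j
  have hle (i : ℕ) : 1 / (q (j + 1 + i) : ℝ) ≤ 1 / (q j : ℝ) * (1 / 2) ^ (1 + i) := by
    rw [add_assoc]; exact hq.inv_add_le j (1 + i)
  have hsum : Summable fun i : ℕ => 1 / (q j : ℝ) * (1 / 2) ^ (1 + i) := by
    simp_rw [pow_add]
    exact (summable_geometric_two.mul_left _).mul_left _
  -- Doubling can be an equality in the first tail term (`1, 2`), so strictness is taken from the
  -- second: `2q(2q+1) > 4q`.
  have hlt : 1 / (q (j + 1 + 1) : ℝ) < 1 / (q j : ℝ) * (1 / 2) ^ (1 + 1) := by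
    have h1 := hq.two_mul_le j
    have h2 := hq.growth (j + 1)
    have h3 := hq.pos j
    have h4 : 4 * q j < q (j + 1 + 1) := by nlinarith
    have h5 : (4 : ℝ) * q j < q (j + 1 + 1) := by exact_mod_cast h4
    calc 1 / (q (j + 1 + 1) : ℝ) < 1 / (4 * q j) := by gcongr
      _ = _ := by field_simp; norm_num
  calc ∑' i, 1 / (q (j + 1 + i) : ℝ) < ∑' i : ℕ, 1 / (q j : ℝ) * (1 / 2) ^ (1 + i) :=
        Summable.tsum_lt_tsum hle hlt (Summable.of_nonneg_of_le (fun k => by positivity) hle hsum)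
          hsum
    _ = 1 / q j := by
      simp_rw [pow_add, ← mul_assoc]
      rw [tsum_mul_left, tsum_geometric_two]; ring

theorem abs_term_le (q : ℕ → ℕ) (e : Fin 2) (k : ℕ) :
    |(-1 : ℝ) ^ k * ((e : ℕ) : ℝ) / (q k : ℝ)| ≤ 1 / q k := by
  rw [abs_div, abs_mul, abs_pow, abs_neg, abs_one, one_pow, one_mul, Nat.abs_cast, Nat.abs_cast]
  gcongr
  exact_mod_cast Nat.le_of_lt_succ e.isLt

theorem IsSecondOstrogradsky.summable_term {q : ℕ → ℕ} (hq : IsSecondOstrogradsky q)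
    (x : ℕ → Fin 2) : Summable fun k : ℕ => (-1 : ℝ) ^ k * ((x k : ℕ) : ℝ) / (q k : ℝ) :=
  Summable.of_norm_bounded hq.summable fun k => abs_term_le q (x k) k

theorem continuous_incompleteSum {q : ℕ → ℕ} (hq : IsSecondOstrogradsky q) :
    Continuous (incompleteSum q) := by
  refine continuous_tsum (u := fun k => 1 / (q k : ℝ)) (fun k => ?_) hq.summable
    fun k x => abs_term_le q (x k) k
  have h : Continuous fun e : Fin 2 => ((e : ℕ) : ℝ) := continuous_of_discreteTopology
  have h' : Continuous fun x : ℕ → Fin 2 => ((x k : ℕ) : ℝ) := h.comp (continuous_apply k)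
  exact (continuous_const.mul h').div_const _

theorem measurable_incompleteSum {q : ℕ → ℕ} (hq : IsSecondOstrogradsky q) :
    Measurable (incompleteSum q) :=
  (continuous_incompleteSum hq).measurable

theorem abs_incompleteSum_sub_sub_lt {q : ℕ → ℕ} (hq : IsSecondOstrogradsky q)
    {x y : ℕ → Fin 2} {j : ℕ} (hlt : ∀ k < j, x k = y k) :
    |incompleteSum q x - incompleteSum q y
      - (-1 : ℝ) ^ j * (((x j : ℕ) : ℝ) - ((y j : ℕ) : ℝ)) / q j| < 1 / q j := by
  have hx := hq.summable_term x
  have hy := hq.summable_term y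
  have key : incompleteSum q x - incompleteSum q y
      - (-1 : ℝ) ^ j * (((x j : ℕ) : ℝ) - ((y j : ℕ) : ℝ)) / q j =
      ∑' i, ((-1 : ℝ) ^ (i + (j + 1)) * ((x (i + (j + 1)) : ℕ) : ℝ) / (q (i + (j + 1)) : ℝ)
        - (-1 : ℝ) ^ (i + (j + 1)) * ((y (i + (j + 1)) : ℕ) : ℝ) / (q (i + (j + 1)) : ℝ)) := by
    unfold incompleteSum
    rw [← hx.tsum_sub hy, ← (hx.sub hy).sum_add_tsum_nat_add (j + 1), Finset.sum_range_succ,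
      Finset.sum_eq_zero]
    · ring
    · intro k hk
      rw [hlt k (Finset.mem_range.1 hk), sub_self]
  rw [key, ← Real.norm_eq_abs]
  have hs : Summable fun i => 1 / (q (i + (j + 1)) : ℝ) :=
    (summable_nat_add_iff (f := fun k => 1 / (q k : ℝ)) (j + 1)).2 hq.summable
  refine lt_of_le_of_lt (tsum_of_norm_bounded hs.hasSum fun i => ?_) ?_
  · rw [Real.norm_eq_abs, ← sub_div, ← mul_sub, abs_div, abs_mul, abs_pow, abs_neg, abs_one,
      one_pow, one_mul, Nat.abs_cast]
    gcongr
    generalize x (i + (j + 1)) = a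
    generalize y (i + (j + 1)) = b
    fin_cases a <;> fin_cases b <;> simp
  · simpa only [add_comm] using hq.tsum_tail_lt j

/-- The leading term `± 1 / q j` beats the remaining difference, so the order is lexicographic with
the direction alternating in `j`. -/
theorem incompleteSum_sub_pos {q : ℕ → ℕ} (hq : IsSecondOstrogradsky q)
    {x y : ℕ → Fin 2} {j : ℕ} (hlt : ∀ k < j, x k = y k) (hx : x j = 1) (hy : y j = 0) :
    0 < (-1 : ℝ) ^ j * (incompleteSum q x - incompleteSum q y) := by
  have h := abs_incompleteSum_sub_sub_lt hq hlt
  have h1 : (((1 : Fin 2) : ℕ) : ℝ) - (((0 : Fin 2) : ℕ) : ℝ) = 1 := by simp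
  rw [hx, hy, h1, abs_lt] at h
  rcases neg_one_pow_eq_or ℝ j with h2 | h2 <;> rw [h2] at h ⊢
  · linarith [h.1]
  · have : (-1 : ℝ) * 1 / q j = - (1 / q j) := by ring
    linarith [h.2]

/-- The word formed by the first `n` digits. -/
def prefixWord (n : ℕ) (x : ℕ → Fin 2) : Fin n → Fin 2 := fun k => x k

theorem prefixWord_eq_iff {n : ℕ} {x y : ℕ → Fin 2} :
    prefixWord n x = prefixWord n y ↔ ∀ k < n, x k = y k :=
  ⟨fun h k hk => congrFun h ⟨k, hk⟩, fun h => funext fun k => h k k.isLt⟩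

theorem measurable_prefixWord (n : ℕ) : Measurable (prefixWord n) :=
  measurable_pi_lambda _ fun k => measurable_pi_apply (k : ℕ)

/-- The digits of the least incomplete sum whose first digits form the word `w`. -/
def lowDigits {n : ℕ} (w : Fin n → Fin 2) (k : ℕ) : Fin 2 :=
  if h : k < n then w ⟨k, h⟩ else if Even k then 0 else 1

/-- The digits of the greatest incomplete sum whose first digits form the word `w`. -/
def highDigits {n : ℕ} (w : Fin n → Fin 2) (k : ℕ) : Fin 2 :=
  if h : k < n then w ⟨k, h⟩ else if Even k then 1 else 0

/-- The least closed interval that contains all incomplete sums whose first digits form `w`. -/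
def hull (q : ℕ → ℕ) {n : ℕ} (w : Fin n → Fin 2) : Set ℝ :=
  Set.Icc (incompleteSum q (lowDigits w)) (incompleteSum q (highDigits w))

theorem incompleteSum_mem_hull {q : ℕ → ℕ} (hq : IsSecondOstrogradsky q) (n : ℕ)
    (x : ℕ → Fin 2) : incompleteSum q x ∈ hull q (prefixWord n x) := by
  have aux (a b : Fin 2) (k : ℕ) (h : (Even k → a ≤ b) ∧ (¬ Even k → b ≤ a)) :
      (-1 : ℝ) ^ k * ((a : ℕ) : ℝ) / (q k : ℝ) ≤ (-1 : ℝ) ^ k * ((b : ℕ) : ℝ) / (q k : ℝ) := by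
    by_cases hk : Even k
    · have : ((a : ℕ) : ℝ) ≤ ((b : ℕ) : ℝ) := by exact_mod_cast h.1 hk
      rw [hk.neg_one_pow]; gcongr
    · have : ((b : ℕ) : ℝ) ≤ ((a : ℕ) : ℝ) := by exact_mod_cast h.2 hk
      rw [(Nat.not_even_iff_odd.1 hk).neg_one_pow]
      gcongr ?_ / _
      linarith
  constructor
  · refine (hq.summable_term _).tsum_le_tsum (fun k => aux _ _ k ?_) (hq.summable_term _)
    unfold lowDigits prefixWord
    split_ifs with h1 h2 <;> simp_all
    omega
  · refine (hq.summable_term _).tsum_le_tsum (fun k => aux _ _ k ?_) (hq.summable_term _)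
    unfold highDigits prefixWord
    split_ifs with h1 h2 <;> simp_all
    omega

/-- At the first disagreement of `y` with `w`, both endpoints of the hull carry the digit of `w`, so
both lie strictly on the same side of the sum of `y`. -/
theorem prefixWord_eq_of_mem_hull {q : ℕ → ℕ} (hq : IsSecondOstrogradsky q) {n : ℕ}
    {w : Fin n → Fin 2} {y : ℕ → Fin 2} (hy : incompleteSum q y ∈ hull q w) :
    prefixWord n y = w := by
  by_contra hne
  have hex : ∃ k, ∃ h : k < n, y k ≠ w ⟨k, h⟩ := by
    by_contra! hcon
    exact hne (funext fun k => hcon k k.isLt)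
  classical
  obtain ⟨hj, hyj⟩ := Nat.find_spec hex
  set j := Nat.find hex with hjdef
  have hmin (k : ℕ) (hk : k < j) : y k = w ⟨k, hk.trans hj⟩ := by
    by_contra hcon
    exact Nat.find_min hex hk ⟨hk.trans hj, hcon⟩
  have hlow (k : ℕ) (hk : k < n) : lowDigits w k = w ⟨k, hk⟩ := by simp [lowDigits, hk]
  have hhigh (k : ℕ) (hk : k < n) : highDigits w k = w ⟨k, hk⟩ := by simp [highDigits, hk]
  have hl1 : ∀ k < j, lowDigits w k = y k := fun k hk => by rw [hlow k (hk.trans hj), hmin k hk]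
  have hh1 : ∀ k < j, highDigits w k = y k := fun k hk => by rw [hhigh k (hk.trans hj), hmin k hk]
  obtain ⟨h1, h2⟩ := hy
  have hcase : (y j = 0 ∧ w ⟨j, hj⟩ = 1) ∨ (y j = 1 ∧ w ⟨j, hj⟩ = 0) := by
    revert hyj; generalize y j = a; generalize w ⟨j, hj⟩ = b
    revert a b; decide
  rcases hcase with ⟨ha, hb⟩ | ⟨ha, hb⟩
  · have e1 := incompleteSum_sub_pos hq hl1 (by rw [hlow j hj, hb]) ha
    have e2 := incompleteSum_sub_pos hq hh1 (by rw [hhigh j hj, hb]) ha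
    rcases neg_one_pow_eq_or ℝ j with h | h <;> rw [h] at e1 e2 <;> linarith
  · have e1 := incompleteSum_sub_pos hq (fun k hk => (hl1 k hk).symm) ha (by rw [hlow j hj, hb])
    have e2 := incompleteSum_sub_pos hq (fun k hk => (hh1 k hk).symm) ha (by rw [hhigh j hj, hb])
    rcases neg_one_pow_eq_or ℝ j with h | h <;> rw [h] at e1 e2 <;> linarith

theorem incompleteSum_mem_hull_iff {q : ℕ → ℕ} (hq : IsSecondOstrogradsky q) {n : ℕ}
    {w : Fin n → Fin 2} {y : ℕ → Fin 2} : incompleteSum q y ∈ hull q w ↔ prefixWord n y = w :=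
  ⟨prefixWord_eq_of_mem_hull hq, fun h => h ▸ incompleteSum_mem_hull hq n y⟩

theorem prefixWord_lowDigits {n : ℕ} (w : Fin n → Fin 2) : prefixWord n (lowDigits w) = w := by
  ext k; simp [prefixWord, lowDigits]

theorem hull_mem_closedIntervals {q : ℕ → ℕ} (hq : IsSecondOstrogradsky q) {n : ℕ}
    (w : Fin n → Fin 2) : hull q w ∈ closedIntervals :=
  ⟨_, _, ((incompleteSum_mem_hull_iff hq).2 (prefixWord_lowDigits w)).2, rfl⟩

/-- The fair coin-tossing measure on sequences of digits. -/
noncomputable def fairMeasure : Measure (ℕ → Fin 2) :=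
  Measure.infinitePi fun _ : ℕ => (PMF.uniformOfFintype (Fin 2)).toMeasure

instance : IsProbabilityMeasure fairMeasure := by
  unfold fairMeasure; infer_instance

theorem fairMeasure_pi (s : Finset ℕ) (x : ℕ → Fin 2) :
    fairMeasure {y | ∀ k ∈ s, y k = x k} = (2 : ℝ≥0∞)⁻¹ ^ s.card := by
  have h : {y : ℕ → Fin 2 | ∀ k ∈ s, y k = x k} = Set.pi s fun k => {x k} := by
    ext y; simp [Set.pi]
  rw [h, fairMeasure, Measure.infinitePi_pi _ (fun _ _ => MeasurableSet.singleton _)]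
  rw [Finset.prod_congr rfl (g := fun _ => (2 : ℝ≥0∞)⁻¹), Finset.prod_const]
  intro k _
  rw [PMF.toMeasure_apply_singleton _ _ (MeasurableSet.singleton _)]
  simp

theorem uniformLaw_hull {q : ℕ → ℕ} (hq : IsSecondOstrogradsky q) {n : ℕ} (w : Fin n → Fin 2) :
    uniformLaw q (hull q w) = (2 : ℝ≥0∞)⁻¹ ^ n := by
  have h : incompleteSum q ⁻¹' hull q w =
      {y | ∀ k ∈ Finset.range n, y k = lowDigits w k} := by
    ext y
    rw [Set.mem_preimage, incompleteSum_mem_hull_iff hq, ← prefixWord_lowDigits w,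
      prefixWord_eq_iff, prefixWord_lowDigits]
    simp
  rw [uniformLaw, Measure.map_apply (measurable_incompleteSum hq) (by exact measurableSet_Icc), h]
  exact (fairMeasure_pi (Finset.range n) (lowDigits w)).trans (by rw [Finset.card_range])

/-- Neither outer point lies in the hull around the middle point, so that whole hull fits between
them. -/
theorem le_uniformLaw_of_between {q : ℕ → ℕ} (hq : IsSecondOstrogradsky q) {n : ℕ} {a b : ℝ}
    {x y z : ℕ → Fin 2} (hx : incompleteSum q x ∈ Set.Icc a b)
    (hz : incompleteSum q z ∈ Set.Icc a b)
    (hxy : incompleteSum q x < incompleteSum q y) (hyz : incompleteSum q y < incompleteSum q z)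
    (hxy' : prefixWord n x ≠ prefixWord n y) (hyz' : prefixWord n z ≠ prefixWord n y) :
    (2 : ℝ≥0∞)⁻¹ ^ n ≤ uniformLaw q (Set.Icc a b) := by
  rw [← uniformLaw_hull hq (prefixWord n y)]
  refine measure_mono (Set.Icc_subset_Icc ?_ ?_) <;>
  have hm := incompleteSum_mem_hull hq n y
  · refine hx.1.trans (le_of_not_gt fun hlt => hxy' ?_)
    exact prefixWord_eq_of_mem_hull hq ⟨hlt.le, hxy.le.trans hm.2⟩
  · refine le_trans (le_of_not_gt fun hlt => hyz' ?_) hz.2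
    exact prefixWord_eq_of_mem_hull hq ⟨hm.1.trans hyz.le, hlt.le⟩

open Classical in
theorem card_prefixWord_le_two {q : ℕ → ℕ} (hq : IsSecondOstrogradsky q) {n : ℕ} {a b : ℝ}
    (h : uniformLaw q (Set.Icc a b) < (2 : ℝ≥0∞)⁻¹ ^ n) :
    (Finset.univ.filter fun w : Fin n → Fin 2 =>
      ∃ x, prefixWord n x = w ∧ incompleteSum q x ∈ Set.Icc a b).card ≤ 2 := by
  by_contra! hcard
  obtain ⟨u, hu, v, hv, w, hw, huv, huw, hvw⟩ := Finset.two_lt_card.1 hcard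
  simp only [Finset.mem_filter, Finset.mem_univ, true_and] at hu hv hw
  obtain ⟨x, rfl, hx⟩ := hu
  obtain ⟨y, rfl, hy⟩ := hv
  obtain ⟨z, rfl, hz⟩ := hw
  have hne {x y : ℕ → Fin 2} (h : prefixWord n x ≠ prefixWord n y) :
      incompleteSum q x < incompleteSum q y ∨ incompleteSum q y < incompleteSum q x := by
    refine lt_or_gt_of_ne fun heq => h ?_
    exact prefixWord_eq_of_mem_hull hq (heq ▸ incompleteSum_mem_hull hq n y)
  refine h.not_ge ?_
  rcases hne huv with h1 | h1 <;> rcases hne huw with h2 | h2 <;> rcases hne hvw with h3 | h3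
  · exact le_uniformLaw_of_between hq hx hz h1 h3 huv hvw.symm
  · exact le_uniformLaw_of_between hq hx hy h2 h3 huw hvw
  · linarith
  · exact le_uniformLaw_of_between hq hz hy h2 h1 huw.symm huv.symm
  · exact le_uniformLaw_of_between hq hy hz h1 h2 huv.symm huw.symm
  · linarith
  · exact le_uniformLaw_of_between hq hy hx h3 h2 hvw huw
  · exact le_uniformLaw_of_between hq hz hx h3 h1 hvw.symm huv

/-! ### Bounds for the Hausdorff–Billingsley measure -/

theorem measure_inter_Icc_le {Ω : Type*} [MeasurableSpace Ω] {P : Measure Ω} {q : ℕ → ℕ}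
    (hq : IsSecondOstrogradsky q) {η : Ω → ℕ → Fin 2} {G : Set Ω} {n : ℕ} {c : ℝ≥0∞}
    (hG : ∀ ω ∈ G, P {ω' | prefixWord n (η ω') = prefixWord n (η ω)} ≤ c) {a b : ℝ}
    (h : uniformLaw q (Set.Icc a b) < (2 : ℝ≥0∞)⁻¹ ^ n) :
    P (G ∩ {ω | incompleteSum q (η ω) ∈ Set.Icc a b}) ≤ 2 * c := by
  classical
  set F := Finset.univ.filter fun w : Fin n → Fin 2 =>
      ∃ x, prefixWord n x = w ∧ incompleteSum q x ∈ Set.Icc a b with hF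
  have hcard : F.card ≤ 2 := by convert card_prefixWord_le_two hq h
  have hsub : G ∩ {ω | incompleteSum q (η ω) ∈ Set.Icc a b} ⊆
      ⋃ w ∈ F, G ∩ {ω | prefixWord n (η ω) = w} := fun ω hω => by
    simp only [Set.mem_iUnion]
    exact ⟨prefixWord n (η ω), by simpa [hF] using ⟨η ω, rfl, hω.2⟩, hω.1, rfl⟩
  calc P (G ∩ {ω | incompleteSum q (η ω) ∈ Set.Icc a b})
      ≤ ∑ w ∈ F, P (G ∩ {ω | prefixWord n (η ω) = w}) :=
        (measure_mono hsub).trans (measure_biUnion_finset_le _ _)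
    _ ≤ ∑ w ∈ F, c := by
      refine Finset.sum_le_sum fun w _ => ?_
      rcases (G ∩ {ω | prefixWord n (η ω) = w}).eq_empty_or_nonempty with h0 | ⟨ω, hω, rfl⟩
      · simp [h0]
      · exact (measure_mono Set.inter_subset_right).trans (hG ω hω)
    _ = F.card * c := by simp
    _ ≤ 2 * c := by gcongr; exact_mod_cast hcard

theorem inv_two_rpow_natCast_mul (n : ℕ) (α : ℝ) :
    (2 : ℝ≥0∞)⁻¹ ^ ((n : ℝ) * α) = ((2 : ℝ≥0∞)⁻¹ ^ α) ^ n := by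
  rw [mul_comm, ENNReal.rpow_mul, ENNReal.rpow_natCast]

theorem inv_two_rpow_lt_one {α : ℝ} (hα : 0 < α) : (2 : ℝ≥0∞)⁻¹ ^ α < 1 :=
  ENNReal.rpow_lt_one (by simp) hα

/-- With `2⁻⁽ⁿ⁺¹⁾ ≤ ν(I) < 2⁻ⁿ`, the interval meets at most two cylinders of rank `n`. This gives
the factor `2`; passing from `2⁻ⁿ` to `ν(I)` costs `2 ^ α`. -/
theorem measure_inter_Icc_le_rpow {Ω : Type*} [MeasurableSpace Ω] {P : Measure Ω} {q : ℕ → ℕ}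
    (hq : IsSecondOstrogradsky q) {η : Ω → ℕ → Fin 2} {G : Set Ω} {N : ℕ} {α : ℝ} (hα : 0 < α)
    (hG : ∀ ω ∈ G, ∀ n ≥ N, P {ω' | prefixWord n (η ω') = prefixWord n (η ω)} ≤
      (2 : ℝ≥0∞)⁻¹ ^ ((n : ℝ) * α)) {a b : ℝ}
    (h : uniformLaw q (Set.Icc a b) ≤ (2 : ℝ≥0∞)⁻¹ ^ (N + 1)) :
    P (G ∩ {ω | incompleteSum q (η ω) ∈ Set.Icc a b}) ≤
      2 * 2 ^ α * uniformLaw q (Set.Icc a b) ^ α := by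
  have hr : (2 : ℝ≥0∞)⁻¹ < 1 := by simp
  have key (n : ℕ) (hn : N ≤ n) (hlt : uniformLaw q (Set.Icc a b) < (2 : ℝ≥0∞)⁻¹ ^ n) :
      P (G ∩ {ω | incompleteSum q (η ω) ∈ Set.Icc a b}) ≤ 2 * ((2 : ℝ≥0∞)⁻¹ ^ α) ^ n := by
    rw [← inv_two_rpow_natCast_mul]
    exact measure_inter_Icc_le hq (fun ω hω => hG ω hω n hn) hlt
  rcases eq_or_ne (uniformLaw q (Set.Icc a b)) 0 with h0 | h0
  -- A null interval satisfies the bound at every rank, so `n` can tend to infinity.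
  · have ht : Tendsto (fun n : ℕ => 2 * ((2 : ℝ≥0∞)⁻¹ ^ α) ^ n) atTop (nhds (2 * 0)) :=
      ENNReal.Tendsto.const_mul
        (ENNReal.tendsto_pow_atTop_nhds_zero_of_lt_one (inv_two_rpow_lt_one hα)) (by simp)
    rw [mul_zero] at ht
    refine (ge_of_tendsto ht ?_).trans zero_le
    filter_upwards [eventually_ge_atTop N] with n hn
    refine key n hn ?_
    rw [h0]
    exact ENNReal.pow_pos (by simp) n
  · have hex : ∃ m : ℕ, (2 : ℝ≥0∞)⁻¹ ^ m ≤ uniformLaw q (Set.Icc a b) :=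
      (((ENNReal.tendsto_pow_atTop_nhds_zero_of_lt_one hr).eventually_lt_const
        (pos_iff_ne_zero.2 h0)).exists).imp fun _ h => h.le
    classical
    have hfind := Nat.find_spec hex
    have hmin := fun k (hk : k < Nat.find hex) => not_le.1 (Nat.find_min hex hk)
    generalize Nat.find hex = m at hfind hmin
    have hm : N + 1 ≤ m := by
      by_contra! hlt
      have h1 := hfind.trans h
      have h2 : (2 : ℝ≥0∞)⁻¹ ^ (N + 1) < (2 : ℝ≥0∞)⁻¹ ^ m := by
          rw [← ENNReal.inv_pow, ← ENNReal.inv_pow, ENNReal.inv_lt_inv]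
          exact_mod_cast Nat.pow_lt_pow_right one_lt_two hlt
      exact h2.not_ge h1
    obtain ⟨n, rfl⟩ : ∃ n, m = n + 1 := ⟨m - 1, by omega⟩
    calc P (G ∩ {ω | incompleteSum q (η ω) ∈ Set.Icc a b})
        ≤ 2 * ((2 : ℝ≥0∞)⁻¹ ^ α) ^ n := key n (by omega) (hmin n (by omega))
      _ = 2 * 2 ^ α * ((2 : ℝ≥0∞)⁻¹ ^ (n + 1)) ^ α := by
        rw [← ENNReal.rpow_natCast (_⁻¹) (n + 1), ← ENNReal.rpow_mul, inv_two_rpow_natCast_mul,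
          pow_succ, ENNReal.inv_rpow, mul_assoc, mul_comm (_ ^ n) _, ← mul_assoc (2 ^ α),
          ENNReal.mul_inv_cancel, one_mul]
        · simp
        · exact ENNReal.rpow_ne_top_of_nonneg hα.le (by simp)
      _ ≤ 2 * 2 ^ α * uniformLaw q (Set.Icc a b) ^ α := by gcongr

/-- Mass distribution principle. The digit sequence `η` and its probability space are arbitrary, so
that it serves both the law of the series and an auxiliary measure on the support. `P` acts as an
outer measure, and no measurability of `E` is needed. -/
theorem billingsleyMeasure_ne_zero {Ω : Type*} [MeasurableSpace Ω] {P : Measure Ω}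
    [IsProbabilityMeasure P] {q : ℕ → ℕ} (hq : IsSecondOstrogradsky q) {η : Ω → ℕ → Fin 2}
    {α : ℝ} (hα : 0 < α)
    (h : ∀ᵐ ω ∂P, ∀ᶠ n : ℕ in atTop, P {ω' | prefixWord n (η ω') = prefixWord n (η ω)} ≤
      (2 : ℝ≥0∞)⁻¹ ^ ((n : ℝ) * α))
    {E : Set ℝ} (hE : ∀ᵐ ω ∂P, incompleteSum q (η ω) ∈ E) :
    billingsleyMeasure (uniformLaw q) closedIntervals α E ≠ 0 := by
  intro hzero
  let G (N : ℕ) : Set Ω := {ω | ∀ n ≥ N, P {ω' | prefixWord n (η ω') = prefixWord n (η ω)} ≤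
      (2 : ℝ≥0∞)⁻¹ ^ ((n : ℝ) * α)}
  -- The sets `G N` cover almost every `ω`, so one of them carries mass and makes the bound uniform
  -- in `ω`.
  have hG : ∃ N, P (G N) ≠ 0 := by
    by_contra! hcon
    have h1 : P (⋃ N, G N) = 0 := measure_iUnion_null hcon
    have h2 : ∀ᵐ ω ∂P, ω ∈ ⋃ N, G N := by
      filter_upwards [h] with ω hω
      exact Set.mem_iUnion.2 (eventually_atTop.1 hω)
    obtain ⟨ω, h3, h4⟩ := (h2.and (measure_eq_zero_iff_ae_notMem.1 h1)).exists
    exact h4 h3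
  obtain ⟨N, hN⟩ := hG
  have hC0 : (2 : ℝ≥0∞) * 2 ^ α ≠ 0 := by simp
  have hC : (2 : ℝ≥0∞) * 2 ^ α ≠ ∞ :=
    ENNReal.mul_ne_top (by simp) (ENNReal.rpow_ne_top_of_nonneg hα.le (by simp))
  have hpre : billingsleyPre (uniformLaw q) closedIntervals α ((2 : ℝ≥0∞)⁻¹ ^ (N + 1)) E = 0 := by
    have := hzero.le
    simp only [billingsleyMeasure, iSup_le_iff] at this
    exact le_antisymm (this _ (ENNReal.pow_pos (by simp) _)) zero_le
  have hlt : billingsleyPre (uniformLaw q) closedIntervals α ((2 : ℝ≥0∞)⁻¹ ^ (N + 1)) E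
      < P (G N) / (2 * 2 ^ α) := by
    rw [hpre]
    exact ENNReal.div_pos hN hC
  simp only [billingsleyPre, iInf_lt_iff] at hlt
  obtain ⟨U, hU, hcov, hlt⟩ := hlt
  have hbound (j : ℕ) : P (G N ∩ {ω | incompleteSum q (η ω) ∈ U j}) ≤
      2 * 2 ^ α * uniformLaw q (U j) ^ α := by
    obtain ⟨h1 | ⟨a, b, -, h1⟩, h2⟩ := hU j
    · simp [h1]
    · rw [h1] at h2 ⊢
      exact measure_inter_Icc_le_rpow hq hα (fun ω hω => hω) h2
  have hle : P (G N) ≤ 2 * 2 ^ α * ∑' j, uniformLaw q (U j) ^ α := by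
    calc P (G N) ≤ P (⋃ j, G N ∩ {ω | incompleteSum q (η ω) ∈ U j}) := by
          refine measure_mono_ae ?_
          filter_upwards [hE] with ω hω hωG
          obtain ⟨j, hj⟩ := Set.mem_iUnion.1 (hcov hω)
          exact Set.mem_iUnion.2 ⟨j, hωG, hj⟩
      _ ≤ ∑' j, P (G N ∩ {ω | incompleteSum q (η ω) ∈ U j}) := measure_iUnion_le _
      _ ≤ ∑' j, 2 * 2 ^ α * uniformLaw q (U j) ^ α := ENNReal.tsum_le_tsum hbound
      _ = _ := ENNReal.tsum_mul_left
  exact (ENNReal.mul_lt_of_lt_div' hlt).not_ge hle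

theorem billingsleyPre_le_tsum {ι : Type*} [Countable ι] {ν : Measure ℝ} {Φ : Set (Set ℝ)}
    {α : ℝ} (hα : 0 < α) {ε : ℝ≥0∞} {E : Set ℝ} (U : ι → Set ℝ) (hU : ∀ i, U i ∈ Φ)
    (hε : ∀ i, ν (U i) ≤ ε) (hE : E ⊆ ⋃ i, U i) :
    billingsleyPre ν Φ α ε E ≤ ∑' i, ν (U i) ^ α := by
  obtain ⟨f, hf⟩ := exists_injective_nat ι
  have hV (j : ℕ) : Function.extend f U (fun _ => ∅) j = ∅ ∨
      ∃ i, f i = j ∧ Function.extend f U (fun _ => ∅) j = U i := by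
    by_cases hj : ∃ i, f i = j
    · obtain ⟨i, rfl⟩ := hj
      exact Or.inr ⟨i, rfl, hf.extend_apply _ _ _⟩
    · exact Or.inl (Function.extend_apply' _ _ _ hj)
  have hsum : ∑' j, ν (Function.extend f U (fun _ => ∅) j) ^ α = ∑' i, ν (U i) ^ α := by
    rw [← hf.tsum_eq]
    · simp_rw [hf.extend_apply]
    · intro j hj
      rcases hV j with h | ⟨i, h, -⟩
      · simp [h, hα] at hj
      · exact ⟨i, h⟩
  rw [← hsum]
  refine iInf_le_of_le (Function.extend f U fun _ => ∅) (iInf_le_of_le (fun j => ?_)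
    (iInf_le_of_le (fun x hx => ?_) le_rfl))
  · rcases hV j with h | ⟨i, -, h⟩ <;> rw [h]
    · simp
    · exact ⟨Or.inr (hU i), hε i⟩
  · obtain ⟨i, hi⟩ := Set.mem_iUnion.1 (hE hx)
    exact Set.mem_iUnion.2 ⟨f i, by rwa [hf.extend_apply]⟩

/-- The hulls of all ranks `n ≥ N` still cover `E`, and they cost at most a geometric tail of ratio
`2^(-(α - β))`. -/
theorem billingsleyMeasure_eq_zero {q : ℕ → ℕ} (hq : IsSecondOstrogradsky q) {α β : ℝ}
    (hα : 0 < α) (hβα : β < α) (W : ∀ n : ℕ, Finset (Fin n → Fin 2))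
    (hW : ∀ n, ((W n).card : ℝ≥0∞) ≤ 2 ^ ((n : ℝ) * β)) {E : Set ℝ}
    (hE : ∀ x ∈ E, ∃ᶠ n in atTop, ∃ w ∈ W n, x ∈ hull q w) :
    billingsleyMeasure (uniformLaw q) closedIntervals α E = 0 := by
  simp only [billingsleyMeasure, ENNReal.iSup_eq_zero]
  intro ε hε
  set s : ℝ≥0∞ := 2⁻¹ ^ (α - β) with hs
  have hs1 : s < 1 := inv_two_rpow_lt_one (sub_pos.2 hβα)
  have hcost (n : ℕ) : ((W n).card : ℝ≥0∞) * ((2 : ℝ≥0∞)⁻¹ ^ n) ^ α ≤ s ^ n := by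
    calc ((W n).card : ℝ≥0∞) * ((2 : ℝ≥0∞)⁻¹ ^ n) ^ α
        ≤ 2 ^ ((n : ℝ) * β) * ((2 : ℝ≥0∞)⁻¹ ^ n) ^ α := by gcongr; exact hW n
      _ = s ^ n := by
        rw [hs, ← inv_two_rpow_natCast_mul, ← ENNReal.rpow_natCast (_⁻¹) n, ← ENNReal.rpow_mul,
          ENNReal.inv_rpow, ENNReal.inv_rpow, ← ENNReal.rpow_neg, ← ENNReal.rpow_neg,
          ← ENNReal.rpow_add _ _ (by simp) (by simp)]
        congr 1; ring
  have hbound (N : ℕ) (hN : (2 : ℝ≥0∞)⁻¹ ^ N ≤ ε) :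
      billingsleyPre (uniformLaw q) closedIntervals α ε E ≤ s ^ N * (1 - s)⁻¹ := by
    calc billingsleyPre (uniformLaw q) closedIntervals α ε E
        ≤ ∑' i : (n : ℕ) × W (N + n), uniformLaw q (hull q i.2.1) ^ α := by
          refine billingsleyPre_le_tsum hα (fun i : (n : ℕ) × W (N + n) => hull q i.2.1)
            (fun i => hull_mem_closedIntervals hq _) (fun i => ?_) fun x hx => ?_
          · rw [uniformLaw_hull hq]
            exact le_trans (pow_le_pow_right_of_le_one' (by simp) (by omega)) hN
          · obtain ⟨n, hn, w, hw, hxw⟩ := (frequently_atTop.1 (hE x hx)) N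
            obtain ⟨k, rfl⟩ := Nat.exists_eq_add_of_le hn
            exact Set.mem_iUnion.2 ⟨⟨k, w, hw⟩, hxw⟩
      _ = ∑' n : ℕ, ((W (N + n)).card : ℝ≥0∞) * ((2 : ℝ≥0∞)⁻¹ ^ (N + n)) ^ α := by
          rw [ENNReal.tsum_sigma']
          simp_rw [uniformLaw_hull hq]
          simp
      _ ≤ ∑' n : ℕ, s ^ (N + n) := ENNReal.tsum_le_tsum fun n => hcost _
      _ = s ^ N * (1 - s)⁻¹ := by
          simp_rw [pow_add]
          rw [ENNReal.tsum_mul_left, ENNReal.tsum_geometric]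
  have ht : Tendsto (fun N : ℕ => s ^ N * (1 - s)⁻¹) atTop (nhds (0 * (1 - s)⁻¹)) :=
    ENNReal.Tendsto.mul_const (ENNReal.tendsto_pow_atTop_nhds_zero_of_lt_one hs1)
      (Or.inr (by simpa using (tsub_pos_of_lt hs1).ne'))
  rw [zero_mul] at ht
  refine le_antisymm (ge_of_tendsto ht ?_) zero_le
  filter_upwards [(ENNReal.tendsto_pow_atTop_nhds_zero_of_lt_one
    (by simp : (2 : ℝ≥0∞)⁻¹ < 1)).eventually_lt_const hε] with N hN
  exact hbound N hN.le

/-! ### The strong law of large numbers for the information of the digits -/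

theorem integral_comp_digit {Ω : Type*} [MeasurableSpace Ω] {P : Measure Ω}
    [IsProbabilityMeasure P] {X : Ω → Fin 2} (hX : Measurable X) (f : Fin 2 → ℝ) :
    ∫ ω, f (X ω) ∂P = P.real {ω | X ω = 0} * f 0 + P.real {ω | X ω = 1} * f 1 := by
  have := Measure.isProbabilityMeasure_map (μ := P) hX.aemeasurable
  rw [← integral_map hX.aemeasurable (f := f) (by fun_prop), integral_fintype (.of_finite),
    Fin.sum_univ_two, map_measureReal_apply hX (.singleton _),
    map_measureReal_apply hX (.singleton _)]
  rfl

/-- Monotonicity traps `S n` between its values at consecutive squares. The gap `2k + 1` moves `H`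
by at most `εn`, and `(k + 1)² ≤ 4n` adds `4εn`; together these give the constant `5`. -/
theorem abs_sub_le_of_abs_sub_sq_le {S H : ℕ → ℝ} (hS : Monotone S) (hH : Monotone H)
    (hH1 : ∀ n, H (n + 1) ≤ H n + 1) {ε : ℝ} (hε : 0 < ε)
    (h : ∀ᶠ k : ℕ in atTop, |S (k ^ 2) - H (k ^ 2)| ≤ ε * (k : ℝ) ^ 2) :
    ∀ᶠ n : ℕ in atTop, |S n - H n| ≤ 5 * ε * n := by
  have hHadd (n m : ℕ) : H (n + m) ≤ H n + m := by
    induction m with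
    | zero => simp
    | succ m ih => push_cast; rw [← add_assoc]; linarith [hH1 (n + m)]
  obtain ⟨K, hK⟩ := eventually_atTop.1 h
  obtain ⟨M, hM⟩ := exists_nat_ge (3 / ε)
  have hsqrt : Tendsto Nat.sqrt atTop atTop :=
    tendsto_atTop_mono' _ (Eventually.of_forall fun n => le_rfl)
      (tendsto_atTop_atTop.2 fun b => ⟨b ^ 2, fun n hn => Nat.le_sqrt'.2 hn⟩)
  filter_upwards [hsqrt.eventually_ge_atTop (max (max K M) 1)] with n hn
  set k := n.sqrt with hk
  have hkK : K ≤ k := (le_max_left _ _).trans ((le_max_left _ _).trans hn)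
  have hkM : M ≤ k := (le_max_right _ _).trans ((le_max_left _ _).trans hn)
  have hk1 : 1 ≤ k := (le_max_right _ _).trans hn
  have h1 : k ^ 2 ≤ n := Nat.sqrt_le' n
  have h2 : n ≤ (k + 1) ^ 2 := (Nat.lt_succ_sqrt' n).le
  have h3 : n ≤ k ^ 2 + (2 * k + 1) := by nlinarith
  have h4 : (k + 1) ^ 2 ≤ n + (2 * k + 1) := by nlinarith
  have a1 := abs_le.1 (hK k hkK)
  have a2 := abs_le.1 (hK (k + 1) (hkK.trans k.le_succ))
  have b1 := hS h1
  have b2 := hS h2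
  have c1 := (hH h3).trans (hHadd _ _)
  have c2 := (hH h4).trans (hHadd _ _)
  push_cast at a1 a2 c1 c2
  have hk1' : (1 : ℝ) ≤ k := by exact_mod_cast hk1
  have h1' : (k : ℝ) ^ 2 ≤ n := by exact_mod_cast h1
  have d1 : 3 ≤ ε * k := by
    have : 3 / ε ≤ k := hM.trans (by exact_mod_cast hkM)
    rw [div_le_iff₀ hε] at this
    linarith
  have d2 : 2 * (k : ℝ) + 1 ≤ ε * n := by nlinarith
  have d3 : ε * ((k : ℝ) + 1) ^ 2 ≤ 4 * (ε * n) := by nlinarith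
  have d4 : ε * (k : ℝ) ^ 2 ≤ ε * n := by nlinarith
  rw [abs_le]
  constructor <;> linarith [a1.1, a2.2]

/-- From `|√x log x| < 2`. The bound is uniform in `x`, so the information of a digit has bounded
variance even when its probabilities approach `0`. -/
theorem mul_log_sq_le {x : ℝ} (h0 : 0 ≤ x) (h1 : x ≤ 1) : x * (-Real.log x) ^ 2 ≤ 4 := by
  rcases h0.eq_or_lt with rfl | h0
  · simp
  have h := Real.abs_log_mul_self_rpow_lt x (1 / 2) h0 h1 (by norm_num)
  rw [← Real.sqrt_eq_rpow] at h
  have h2 : x * (-Real.log x) ^ 2 = |Real.log x * √x| ^ 2 := by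
    rw [sq_abs, mul_pow, Real.sq_sqrt h0.le]; ring
  rw [h2]
  have h3 := abs_nonneg (Real.log x * √x)
  nlinarith

theorem digitProb_nonneg {Ω : Type*} [MeasurableSpace Ω] {P : Measure Ω} {ξ : ℕ → Ω → Fin 2}
    {p : Fin 2 → ℕ → ℝ} (hp : ∀ i k, P.real {ω | ξ k ω = i} = p i k) (i : Fin 2) (k : ℕ) :
    0 ≤ p i k := hp i k ▸ measureReal_nonneg

section Digits

variable {Ω : Type*} [MeasurableSpace Ω] {P : Measure Ω} [IsProbabilityMeasure P]
  {ξ : ℕ → Ω → Fin 2} {p : Fin 2 → ℕ → ℝ}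

theorem digitProb_le_one (hp : ∀ i k, P.real {ω | ξ k ω = i} = p i k) (i : Fin 2) (k : ℕ) :
    p i k ≤ 1 := hp i k ▸ measureReal_le_one

theorem digitProb_add (hmeas : ∀ k, Measurable (ξ k))
    (hp : ∀ i k, P.real {ω | ξ k ω = i} = p i k) (k : ℕ) : p 0 k + p 1 k = 1 := by
  have := integral_comp_digit (P := P) (hmeas k) fun _ => 1
  simpa [hp] using this.symm

theorem digitEntropy_nonneg (hp : ∀ i k, P.real {ω | ξ k ω = i} = p i k) (k : ℕ) :
    0 ≤ -(p 0 k * Real.log (p 0 k) + p 1 k * Real.log (p 1 k)) := by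
  have h (i : Fin 2) : p i k * Real.log (p i k) ≤ 0 :=
    mul_nonpos_of_nonneg_of_nonpos (digitProb_nonneg hp i k)
      (Real.log_nonpos (digitProb_nonneg hp i k) (digitProb_le_one hp i k))
  linarith [h 0, h 1]

theorem digitEntropy_le_one (hmeas : ∀ k, Measurable (ξ k))
    (hp : ∀ i k, P.real {ω | ξ k ω = i} = p i k) (k : ℕ) :
    -(p 0 k * Real.log (p 0 k) + p 1 k * Real.log (p 1 k)) ≤ 1 := by
  have h := Real.binEntropy_le_log_two (p := p 0 k)
  have h1 : 1 - p 0 k = p 1 k := by linarith [digitProb_add hmeas hp k]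
  rw [Real.binEntropy, h1, Real.log_inv, Real.log_inv] at h
  have := Real.log_two_lt_d9
  linarith

theorem variance_information_le (hmeas : ∀ k, Measurable (ξ k))
    (hp : ∀ i k, P.real {ω | ξ k ω = i} = p i k) (k : ℕ) :
    Var[fun ω => -Real.log (p (ξ k ω) k); P] ≤ 8 := by
  refine (variance_le_expectation_sq (Measurable.aestronglyMeasurable ?_)).trans ?_
  · exact (measurable_of_finite fun i => -Real.log (p i k)).comp (hmeas k)
  · have := integral_comp_digit (P := P) (hmeas k) fun i => (-Real.log (p i k)) ^ 2
    rw [hp, hp] at this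
    have h (i : Fin 2) := mul_log_sq_le (digitProb_nonneg hp i k) (digitProb_le_one hp i k)
    calc _ = _ := this
      _ ≤ 8 := by linarith [h 0, h 1]

theorem memLp_information (hmeas : ∀ k, Measurable (ξ k)) (p : Fin 2 → ℕ → ℝ) (k : ℕ) :
    MemLp (fun ω => -Real.log (p (ξ k ω) k)) 2 P := by
  refine MemLp.of_bound (Measurable.aestronglyMeasurable
    ((measurable_of_finite fun i => -Real.log (p i k)).comp (hmeas k)))
    (|Real.log (p 0 k)| + |Real.log (p 1 k)|) (Eventually.of_forall fun ω => ?_)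
  rw [norm_neg, Real.norm_eq_abs]
  generalize ξ k ω = i
  fin_cases i <;> simp

theorem measure_information_deviation_le (hmeas : ∀ k, Measurable (ξ k)) (hindep : iIndepFun ξ P)
    (hp : ∀ i k, P.real {ω | ξ k ω = i} = p i k) {c : ℝ} (hc : 0 < c) (n : ℕ) :
    P {ω | c ≤ |∑ k ∈ Finset.range n, -Real.log (p (ξ k ω) k) - entropySum p n|} ≤
      ENNReal.ofReal (8 * n / c ^ 2) := by
  have hmem (k : ℕ) := memLp_information (P := P) hmeas p k
  have hsum : MemLp (fun ω => ∑ k ∈ Finset.range n, -Real.log (p (ξ k ω) k)) 2 P :=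
    memLp_finsetSum _ fun k _ => hmem k
  have hmean : ∫ ω, ∑ k ∈ Finset.range n, -Real.log (p (ξ k ω) k) ∂P = entropySum p n := by
    rw [integral_finsetSum _ fun k _ => (hmem k).integrable one_le_two]
    refine Finset.sum_congr rfl fun k _ => ?_
    rw [integral_comp_digit (P := P) (hmeas k) fun i => -Real.log (p i k), hp, hp]
    ring
  have hvar : Var[fun ω => ∑ k ∈ Finset.range n, -Real.log (p (ξ k ω) k); P] ≤ 8 * n := by
    have h := IndepFun.variance_sum (s := Finset.range n)
      (X := fun k ω => -Real.log (p (ξ k ω) k)) (μ := P) (fun k _ => hmem k) fun i _ j _ hij =>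
        (hindep.indepFun hij).comp (measurable_of_finite fun a => -Real.log (p a i))
          (measurable_of_finite fun a => -Real.log (p a j))
    have h' : (fun ω => ∑ k ∈ Finset.range n, -Real.log (p (ξ k ω) k)) =
        ∑ k ∈ Finset.range n, fun ω => -Real.log (p (ξ k ω) k) := by
      ext ω; simp
    rw [h', h]
    calc _ ≤ ∑ k ∈ Finset.range n, (8 : ℝ) :=
          Finset.sum_le_sum fun k _ => variance_information_le hmeas hp k
      _ = 8 * n := by simp [mul_comm]
  have h := meas_ge_le_variance_div_sq hsum hc
  rw [hmean] at h
  exact h.trans (ENNReal.ofReal_le_ofReal (by gcongr))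

/-- Along the squares `n = (m + 1)²`, Chebyshev's bound is `8 / (δ² (m + 1)²)`, which is summable.
Borel–Cantelli applies there, and interpolation between squares costs the factor `5` built into `δ`.
-/
theorem ae_eventually_abs_information_sub_le (hmeas : ∀ k, Measurable (ξ k))
    (hindep : iIndepFun ξ P) (hp : ∀ i k, P.real {ω | ξ k ω = i} = p i k) {ε : ℝ} (hε : 0 < ε) :
    ∀ᵐ ω ∂P, ∀ᶠ n : ℕ in atTop,
      |∑ k ∈ Finset.range n, -Real.log (p (ξ k ω) k) - entropySum p n| ≤ ε * n := by
  set δ := ε / 5 with hδ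
  have hδ0 : 0 < δ := by positivity
  have hsum : ∑' m : ℕ, P {ω | δ * ((m + 1 : ℕ) : ℝ) ^ 2 ≤
      |∑ k ∈ Finset.range ((m + 1) ^ 2), -Real.log (p (ξ k ω) k) - entropySum p ((m + 1) ^ 2)|}
        ≠ ∞ := by
    have hs : Summable fun m : ℕ => 8 / δ ^ 2 * (1 / ((m + 1 : ℕ) : ℝ) ^ 2) :=
      ((summable_nat_add_iff 1).2
        (Real.summable_one_div_nat_pow.2 one_lt_two)).mul_left (8 / δ ^ 2)
    refine ne_top_of_le_ne_top hs.tsum_ofReal_ne_top (ENNReal.tsum_le_tsum fun m => ?_)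
    refine (measure_information_deviation_le hmeas hindep hp (by positivity) _).trans (le_of_eq ?_)
    congr 1
    push_cast
    field_simp
  filter_upwards [ae_eventually_notMem hsum] with ω hω
  have h := abs_sub_le_of_abs_sub_sq_le
    (S := fun n => ∑ k ∈ Finset.range n, -Real.log (p (ξ k ω) k)) (H := entropySum p)
    (monotone_nat_of_le_succ fun n => ?_) (monotone_nat_of_le_succ fun n => ?_) (fun n => ?_) hδ0 ?_
  · filter_upwards [h] with n hn
    calc _ ≤ 5 * δ * n := hn
      _ = ε * n := by rw [hδ]; ring
  · rw [Finset.sum_range_succ]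
    have := Real.log_nonpos (digitProb_nonneg hp (ξ n ω) n) (digitProb_le_one hp (ξ n ω) n)
    linarith
  · rw [entropySum, entropySum, Finset.sum_range_succ]
    linarith [digitEntropy_nonneg hp n]
  · rw [entropySum, entropySum, Finset.sum_range_succ]
    linarith [digitEntropy_le_one hmeas hp n]
  · obtain ⟨M, hM⟩ := eventually_atTop.1 hω
    refine eventually_atTop.2 ⟨M + 1, fun k hk => ?_⟩
    obtain ⟨m, rfl⟩ : ∃ m, k = m + 1 := ⟨k - 1, by omega⟩
    exact (not_le.1 (hM m (by omega))).le

/-- Because `Real.log 0 = 0`, the information recovers the cylinder mass only where every digit has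
positive probability. -/
theorem ae_digitProb_pos (hp : ∀ i k, P.real {ω | ξ k ω = i} = p i k) :
    ∀ᵐ ω ∂P, ∀ k, 0 < p (ξ k ω) k := by
  rw [ae_all_iff]
  intro k
  have h (i : Fin 2) : ∀ᵐ ω ∂P, ξ k ω = i → 0 < p i k := by
    rcases (digitProb_nonneg hp i k).eq_or_lt with h0 | h0
    · have : P {ω | ξ k ω = i} = 0 := by
        rw [← measureReal_eq_zero_iff, hp, ← h0]
      filter_upwards [measure_eq_zero_iff_ae_notMem.1 this] with ω hω hi
      exact absurd hi hω
    · exact Eventually.of_forall fun _ _ => h0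
  filter_upwards [ae_all_iff.2 h] with ω hω using hω _ rfl

theorem measure_prefixWord_eq (hindep : iIndepFun ξ P)
    (hp : ∀ i k, P.real {ω | ξ k ω = i} = p i k) (n : ℕ) (x : ℕ → Fin 2) :
    P {ω | prefixWord n (fun k => ξ k ω) = prefixWord n x} =
      ENNReal.ofReal (∏ k ∈ Finset.range n, p (x k) k) := by
  have h := hindep.measure_inter_preimage_eq_mul (Finset.range n) (sets := fun k => {x k})
    fun k _ => .singleton _
  have hset : {ω | prefixWord n (fun k => ξ k ω) = prefixWord n x} =
      ⋂ k ∈ Finset.range n, ξ k ⁻¹' {x k} := by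
    ext ω; simp [prefixWord_eq_iff]
  rw [hset, h, ENNReal.ofReal_prod_of_nonneg fun k _ => digitProb_nonneg hp _ k]
  refine Finset.prod_congr rfl fun k _ => ?_
  rw [← hp, ofReal_measureReal]
  rfl

theorem measure_prefixWord_eq_exp (hindep : iIndepFun ξ P)
    (hp : ∀ i k, P.real {ω | ξ k ω = i} = p i k) (n : ℕ) {x : ℕ → Fin 2}
    (hx : ∀ k, 0 < p (x k) k) :
    P {ω | prefixWord n (fun k => ξ k ω) = prefixWord n x} =
      ENNReal.ofReal (Real.exp (-∑ k ∈ Finset.range n, -Real.log (p (x k) k))) := by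
  rw [measure_prefixWord_eq hindep hp, Finset.sum_neg_distrib, neg_neg, Real.exp_sum]
  congr 1
  exact Finset.prod_congr rfl fun k _ => (Real.exp_log (hx k)).symm

end Digits

/-! ### Dimensions of the law of the series and of its support -/

theorem two_rpow_eq_ofReal_exp (x : ℝ) :
    (2 : ℝ≥0∞) ^ x = ENNReal.ofReal (Real.exp (x * Real.log 2)) := by
  rw [mul_comm, ← Real.rpow_def_of_pos two_pos, ← ENNReal.ofReal_rpow_of_pos two_pos,
    ENNReal.ofReal_ofNat]

theorem inv_two_rpow_eq_ofReal_exp (x : ℝ) :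
    (2 : ℝ≥0∞)⁻¹ ^ x = ENNReal.ofReal (Real.exp (-(x * Real.log 2))) := by
  rw [ENNReal.inv_rpow, ← ENNReal.rpow_neg, two_rpow_eq_ofReal_exp, neg_mul]

theorem billingsleyDim_le {ν : Measure ℝ} {E : Set ℝ} {α : ℝ} (hα : 0 < α)
    (h : billingsleyMeasure ν closedIntervals α E = 0) : billingsleyDim E ν ≤ α :=
  iInf_le_of_le α (iInf_le_of_le hα (iInf_le_of_le h le_rfl))

theorem le_billingsleyDim {ν : Measure ℝ} {E : Set ℝ} {d : EReal}
    (h : ∀ α : ℝ, 0 < α → (α : EReal) < d → billingsleyMeasure ν closedIntervals α E ≠ 0) :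
    d ≤ billingsleyDim E ν :=
  le_iInf fun α => le_iInf fun hα => le_iInf fun h0 => le_of_not_gt fun hlt => h α hα hlt h0

open Classical in
-- Outside the free positions only one digit can have positive probability, so a word is recovered
-- from the free positions where it has a `1`.
theorem card_admissible_le (p : Fin 2 → ℕ → ℝ) (n : ℕ) :
    (Finset.univ.filter fun w : Fin n → Fin 2 => ∀ k : Fin n, 0 < p (w k) k).card ≤
      2 ^ freeCount p n := by
  rw [freeCount, ← Finset.card_powerset]
  refine Finset.card_le_card_of_injOn (fun w => ((Finset.range n).filter fun j =>
    0 < p 0 j * p 1 j).filter fun j => ∃ h : j < n, w ⟨j, h⟩ = 1) (fun w _ => ?_) ?_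
  · exact Finset.mem_coe.2 (Finset.mem_powerset.2 (Finset.filter_subset _ _))
  · intro v hv w hw hvw
    simp only [Finset.coe_filter, Finset.mem_univ, true_and, Set.mem_ofPred_eq] at hv hw
    funext k
    by_cases hk : 0 < p 0 k * p 1 k
    · have h := congrArg (fun s => (k : ℕ) ∈ s) hvw
      simp only [Finset.mem_filter, Finset.mem_range, k.isLt, hk, true_and, Fin.eta,
        exists_true_left, eq_iff_iff] at h
      revert h
      generalize v k = a
      generalize w k = b
      revert a b
      decide
    · have h1 := hv k
      have h2 := hw k
      revert h1 h2
      generalize v k = a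
      generalize w k = b
      intro h1 h2
      fin_cases a <;> fin_cases b
      · rfl
      · exact absurd (mul_pos h1 h2) hk
      · exact absurd (mul_pos h2 h1) hk
      · rfl

section Digits

variable {Ω : Type*} [MeasurableSpace Ω] {P : Measure Ω} [IsProbabilityMeasure P] {q : ℕ → ℕ}
  {ξ : ℕ → Ω → Fin 2} {p : Fin 2 → ℕ → ℝ}

theorem le_billingsleyDim_of_ae_mem (hq : IsSecondOstrogradsky q) (hmeas : ∀ k, Measurable (ξ k))
    (hindep : iIndepFun ξ P) (hp : ∀ i k, P.real {ω | ξ k ω = i} = p i k) {E : Set ℝ}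
    (hE : ∀ᵐ ω ∂P, incompleteSum q (fun k => ξ k ω) ∈ E) :
    liminf (fun n : ℕ => ((entropySum p n / ((n : ℝ) * Real.log 2) : ℝ) : EReal)) atTop ≤
      billingsleyDim E (uniformLaw q) := by
  refine le_billingsleyDim fun α hα hlt => ?_
  obtain ⟨β, hαβ, hβ⟩ := EReal.lt_iff_exists_real_btwn.1 hlt
  have hαβ : α < β := by exact_mod_cast hαβ
  have hlog : 0 < Real.log 2 := Real.log_pos one_lt_two
  refine billingsleyMeasure_ne_zero hq (η := fun ω k => ξ k ω) hα ?_ hE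
  -- The tolerance `(β - α) log 2` is exactly what turns `H_n > nβ log 2` into information at least
  -- `nα log 2`.
  filter_upwards [ae_digitProb_pos hp, ae_eventually_abs_information_sub_le hmeas hindep hp
    (mul_pos (sub_pos.2 hαβ) hlog)] with ω hpos hω
  filter_upwards [hω, eventually_lt_of_lt_liminf hβ, eventually_gt_atTop 0] with n hn hn' hn0
  rw [measure_prefixWord_eq_exp hindep hp n hpos, inv_two_rpow_eq_ofReal_exp]
  have hn0' : (0 : ℝ) < n := by exact_mod_cast hn0
  have h1 : β < entropySum p n / (n * Real.log 2) := by exact_mod_cast hn'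
  rw [lt_div_iff₀ (by positivity)] at h1
  have h2 := (abs_le.1 hn).1
  gcongr
  linarith

/-- The cylinders are disjoint, so their masses sum to at most `1`. -/
theorem card_filter_le_two_rpow (hmeas : ∀ k, Measurable (ξ k)) (n : ℕ) (β : ℝ)
    [DecidablePred fun w : Fin n → Fin 2 =>
      (2 : ℝ≥0∞)⁻¹ ^ ((n : ℝ) * β) ≤ P {ω | prefixWord n (fun k => ξ k ω) = w}] :
    ((Finset.univ.filter fun w : Fin n → Fin 2 => (2 : ℝ≥0∞)⁻¹ ^ ((n : ℝ) * β) ≤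
      P {ω | prefixWord n (fun k => ξ k ω) = w}).card : ℝ≥0∞) ≤ 2 ^ ((n : ℝ) * β) := by
  set W := Finset.univ.filter fun w : Fin n → Fin 2 => (2 : ℝ≥0∞)⁻¹ ^ ((n : ℝ) * β) ≤
      P {ω | prefixWord n (fun k => ξ k ω) = w} with hW
  have hm : Measurable fun ω => prefixWord n fun k => ξ k ω :=
    (measurable_prefixWord n).comp (measurable_pi_lambda _ hmeas)
  have h : (W.card : ℝ≥0∞) * (2 : ℝ≥0∞)⁻¹ ^ ((n : ℝ) * β) ≤ 1 := by
    calc (W.card : ℝ≥0∞) * (2 : ℝ≥0∞)⁻¹ ^ ((n : ℝ) * β)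
        = ∑ w ∈ W, (2 : ℝ≥0∞)⁻¹ ^ ((n : ℝ) * β) := by simp
      _ ≤ ∑ w ∈ W, P ((fun ω => prefixWord n fun k => ξ k ω) ⁻¹' {w}) :=
        Finset.sum_le_sum fun w hw => (Finset.mem_filter.1 hw).2
      _ = P ((fun ω => prefixWord n fun k => ξ k ω) ⁻¹' W) :=
        sum_measure_preimage_singleton _ fun w _ => hm (.singleton w)
      _ ≤ 1 := prob_le_one
  rw [ENNReal.inv_rpow, ← div_eq_mul_inv, ENNReal.div_le_iff_le_mul (by simp) (by simp)] at h
  simpa using h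

theorem billingsleyDimMeasure_le (hq : IsSecondOstrogradsky q) (hmeas : ∀ k, Measurable (ξ k))
    (hindep : iIndepFun ξ P) (hp : ∀ i k, P.real {ω | ξ k ω = i} = p i k) :
    billingsleyDimMeasure (seriesLaw P q ξ) (uniformLaw q) ≤
      liminf (fun n : ℕ => ((entropySum p n / ((n : ℝ) * Real.log 2) : ℝ) : EReal)) atTop := by
  classical
  have hlog : 0 < Real.log 2 := Real.log_pos one_lt_two
  refine EReal.le_of_forall_lt_iff_le.1 fun α hα => ?_
  have hα0 : 0 < α := by
    have h0 : (0 : EReal) ≤ liminf (fun n : ℕ =>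
        ((entropySum p n / ((n : ℝ) * Real.log 2) : ℝ) : EReal)) atTop := by
      refine le_liminf_of_le (h := Eventually.of_forall fun n => ?_)
      have : 0 ≤ entropySum p n := Finset.sum_nonneg fun k _ => digitEntropy_nonneg hp k
      exact_mod_cast (by positivity : 0 ≤ entropySum p n / ((n : ℝ) * Real.log 2))
    exact_mod_cast h0.trans_lt hα
  -- Two gaps are needed in `liminf < γ < β < α`: `β - γ` absorbs the fluctuation of the
  -- information, and `α - β` makes the cover's cost summable.
  obtain ⟨β, hβ, hβα⟩ := EReal.lt_iff_exists_real_btwn.1 hα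
  obtain ⟨γ, hγ, hγβ⟩ := EReal.lt_iff_exists_real_btwn.1 hβ
  have hβα : β < α := by exact_mod_cast hβα
  have hγβ : γ < β := by exact_mod_cast hγβ
  let W (n : ℕ) : Finset (Fin n → Fin 2) := Finset.univ.filter fun w =>
    (2 : ℝ≥0∞)⁻¹ ^ ((n : ℝ) * β) ≤ P {ω | prefixWord n (fun k => ξ k ω) = w}
  let E : Set ℝ := {x | ∃ᶠ n in atTop, ∃ w ∈ W n, x ∈ hull q w}
  have hEm : MeasurableSet E := by
    have : E = ⋂ N : ℕ, ⋃ n ≥ N, ⋃ w ∈ W n, hull q w := by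
      ext x
      simp [E, frequently_atTop]
    rw [this]
    exact .iInter fun N => .iUnion fun n => .iUnion fun _ => Finset.measurableSet_biUnion _
      fun w _ => measurableSet_Icc
  have hE1 : seriesLaw P q ξ E = 1 := by
    have hφ : Measurable fun ω => incompleteSum q fun k => ξ k ω :=
      (measurable_incompleteSum hq).comp (measurable_pi_lambda _ hmeas)
    rw [seriesLaw, Measure.map_apply hφ hEm, ← mem_ae_iff_prob_eq_one (hφ hEm)]
    filter_upwards [ae_digitProb_pos hp, ae_eventually_abs_information_sub_le hmeas hindep hp
      (mul_pos (sub_pos.2 hγβ) hlog)] with ω hpos hω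
    -- The bound `H_n < nγ log 2` holds for infinitely many `n` only, which is why `E` is a limsup
    -- set.
    refine ((frequently_lt_of_liminf_lt (h := hγ)).and_eventually
      (hω.and (eventually_gt_atTop 0))).mono fun n ⟨hn', hn, hn0⟩ => ?_
    refine ⟨prefixWord n fun k => ξ k ω, ?_, incompleteSum_mem_hull hq n _⟩
    simp only [W, Finset.mem_filter, Finset.mem_univ, true_and]
    rw [measure_prefixWord_eq_exp hindep hp n hpos, inv_two_rpow_eq_ofReal_exp]
    have hn0' : (0 : ℝ) < n := by exact_mod_cast hn0
    have h1 : entropySum p n / (n * Real.log 2) < γ := by exact_mod_cast hn'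
    rw [div_lt_iff₀ (by positivity)] at h1
    have h2 := (abs_le.1 hn).2
    gcongr
    linarith
  refine iInf_le_of_le E (iInf_le_of_le hEm (iInf_le_of_le hE1 (billingsleyDim_le hα0 ?_)))
  exact billingsleyMeasure_eq_zero hq hα0 hβα W (fun n => card_filter_le_two_rpow hmeas n β)
    fun x hx => hx

theorem billingsleyDimMeasure_eq (hq : IsSecondOstrogradsky q) (hmeas : ∀ k, Measurable (ξ k))
    (hindep : iIndepFun ξ P) (hp : ∀ i k, P.real {ω | ξ k ω = i} = p i k) :
    billingsleyDimMeasure (seriesLaw P q ξ) (uniformLaw q) =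
      liminf (fun n : ℕ => ((entropySum p n / ((n : ℝ) * Real.log 2) : ℝ) : EReal)) atTop := by
  refine le_antisymm (billingsleyDimMeasure_le hq hmeas hindep hp)
    (le_iInf fun E => le_iInf fun hEm => le_iInf fun hE1 =>
      le_billingsleyDim_of_ae_mem hq hmeas hindep hp ?_)
  have hφ : Measurable fun ω => incompleteSum q fun k => ξ k ω :=
    (measurable_incompleteSum hq).comp (measurable_pi_lambda _ hmeas)
  rwa [seriesLaw, Measure.map_apply hφ hEm, ← mem_ae_iff_prob_eq_one (hφ hEm)] at hE1

/-- By continuity every neighbourhood of the sum contains the image of a cylinder around `x`, and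
that cylinder has positive mass. -/
theorem incompleteSum_mem_support (hq : IsSecondOstrogradsky q) (hmeas : ∀ k, Measurable (ξ k))
    (hindep : iIndepFun ξ P) (hp : ∀ i k, P.real {ω | ξ k ω = i} = p i k) {x : ℕ → Fin 2}
    (hx : ∀ k, 0 < p (x k) k) : incompleteSum q x ∈ (seriesLaw P q ξ).support := by
  have hφ : Measurable fun ω => incompleteSum q fun k => ξ k ω :=
    (measurable_incompleteSum hq).comp (measurable_pi_lambda _ hmeas)
  rw [Measure.mem_support_iff_forall]
  intro U hU
  have hV := (continuous_incompleteSum hq).continuousAt.preimage_mem_nhds hU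
  rw [nhds_pi, Filter.mem_pi] at hV
  obtain ⟨I, hI, t, ht, hsub⟩ := hV
  obtain ⟨n, hn⟩ := hI.bddAbove
  have hcyl : {ω | prefixWord (n + 1) (fun k => ξ k ω) = prefixWord (n + 1) x} ⊆
      (fun ω => incompleteSum q fun k => ξ k ω) ⁻¹' U := fun ω hω => by
    refine hsub fun k hk => ?_
    have := prefixWord_eq_iff.1 hω k (Nat.lt_succ_of_le (hn hk))
    rw [this]
    exact mem_of_mem_nhds (ht k)
  calc 0 < P {ω | prefixWord (n + 1) (fun k => ξ k ω) = prefixWord (n + 1) x} := by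
        rw [measure_prefixWord_eq_exp hindep hp _ hx, ENNReal.ofReal_pos]
        exact Real.exp_pos _
    _ ≤ P ((fun ω => incompleteSum q fun k => ξ k ω) ⁻¹' U) := measure_mono hcyl
    _ ≤ seriesLaw P q ξ U := Measure.le_map_apply hφ.aemeasurable U

open Classical in
/-- The sequence that agrees with `x` at the random digits and takes the almost sure value at the
other ones. -/
noncomputable def admissible (p : Fin 2 → ℕ → ℝ) (x : ℕ → Fin 2) (k : ℕ) : Fin 2 :=
  if 0 < p 0 k * p 1 k then x k else if 0 < p 0 k then 0 else 1

theorem digitProb_admissible_pos (hmeas : ∀ k, Measurable (ξ k))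
    (hp : ∀ i k, P.real {ω | ξ k ω = i} = p i k) (x : ℕ → Fin 2) (k : ℕ) :
    0 < p (admissible p x k) k := by
  have h0 := digitProb_nonneg hp 0 k
  have h1 := digitProb_nonneg hp 1 k
  have hadd := digitProb_add hmeas hp k
  unfold admissible
  split_ifs with h h'
  · generalize x k = i
    fin_cases i
    · exact pos_of_mul_pos_left h h1
    · exact pos_of_mul_pos_right h h0
  · exact h'
  · linarith

theorem fairMeasure_admissible_le (p : Fin 2 → ℕ → ℝ) (n : ℕ) (x : ℕ → Fin 2) :
    fairMeasure {y | prefixWord n (admissible p y) = prefixWord n (admissible p x)} ≤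
      (2 : ℝ≥0∞)⁻¹ ^ freeCount p n := by
  classical
  rw [freeCount, ← fairMeasure_pi _ x]
  refine measure_mono fun y hy k hk => ?_
  rw [Finset.mem_filter, Finset.mem_range] at hk
  have := prefixWord_eq_iff.1 hy k hk.1
  simpa [admissible, hk.2] using this

/-- The law of `ξ` may be too uneven on its support, so the mass distribution used is the image of
`fairMeasure` under `admissible p`, whose cylinders of rank `n` have mass at most `2^(-N_n)`. -/
theorem le_billingsleyDim_support (hq : IsSecondOstrogradsky q) (hmeas : ∀ k, Measurable (ξ k))
    (hindep : iIndepFun ξ P) (hp : ∀ i k, P.real {ω | ξ k ω = i} = p i k) :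
    liminf (fun k : ℕ => (((freeCount p k : ℝ) / (k : ℝ) : ℝ) : EReal)) atTop ≤
      billingsleyDim (seriesLaw P q ξ).support (uniformLaw q) := by
  refine le_billingsleyDim fun α hα hlt => ?_
  refine billingsleyMeasure_ne_zero (P := fairMeasure) hq (η := admissible p) hα
    (Eventually.of_forall fun x => ?_) (Eventually.of_forall fun x =>
      incompleteSum_mem_support hq hmeas hindep hp (digitProb_admissible_pos hmeas hp x))
  filter_upwards [eventually_lt_of_lt_liminf hlt, eventually_gt_atTop 0] with n hn hn0
  refine (fairMeasure_admissible_le p n x).trans ?_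
  have hn0' : (0 : ℝ) < n := by exact_mod_cast hn0
  have h1 : α < freeCount p n / (n : ℝ) := by exact_mod_cast hn
  rw [lt_div_iff₀ hn0'] at h1
  rw [← ENNReal.rpow_natCast]
  exact ENNReal.rpow_le_rpow_of_exponent_ge (by simp) (by linarith)

open Classical in
-- The finite union of hulls is closed and has full measure.
theorem support_subset_iUnion_hull (hq : IsSecondOstrogradsky q) (hmeas : ∀ k, Measurable (ξ k))
    (hp : ∀ i k, P.real {ω | ξ k ω = i} = p i k) (n : ℕ) :
    (seriesLaw P q ξ).support ⊆ ⋃ w ∈ Finset.univ.filter fun w : Fin n → Fin 2 =>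
      ∀ k : Fin n, 0 < p (w k) k, hull q w := by
  have hφ : Measurable fun ω => incompleteSum q fun k => ξ k ω :=
    (measurable_incompleteSum hq).comp (measurable_pi_lambda _ hmeas)
  have hclosed : IsClosed (⋃ w ∈ Finset.univ.filter fun w : Fin n → Fin 2 =>
      ∀ k : Fin n, 0 < p (w k) k, hull q w) :=
    isClosed_biUnion_finset fun w _ => isClosed_Icc
  refine Measure.support_subset_of_isClosed hclosed ?_
  refine (ae_map_iff hφ.aemeasurable hclosed.measurableSet).2 ?_
  filter_upwards [ae_digitProb_pos hp] with ω hω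
  refine Set.mem_biUnion (x := prefixWord n fun k => ξ k ω) ?_ (incompleteSum_mem_hull hq n _)
  simpa [prefixWord] using fun k : Fin n => hω k

theorem billingsleyDim_support_le (hq : IsSecondOstrogradsky q) (hmeas : ∀ k, Measurable (ξ k))
    (hp : ∀ i k, P.real {ω | ξ k ω = i} = p i k) :
    billingsleyDim (seriesLaw P q ξ).support (uniformLaw q) ≤
      liminf (fun k : ℕ => (((freeCount p k : ℝ) / (k : ℝ) : ℝ) : EReal)) atTop := by
  classical
  refine EReal.le_of_forall_lt_iff_le.1 fun α hα => ?_
  have hα0 : 0 < α := by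
    have h0 : (0 : EReal) ≤ liminf (fun k : ℕ =>
        (((freeCount p k : ℝ) / (k : ℝ) : ℝ) : EReal)) atTop := by
      refine le_liminf_of_le (h := Eventually.of_forall fun n => ?_)
      exact_mod_cast (by positivity : 0 ≤ (freeCount p n : ℝ) / (n : ℝ))
    exact_mod_cast h0.trans_lt hα
  obtain ⟨β, hβ, hβα⟩ := EReal.lt_iff_exists_real_btwn.1 hα
  have hβα : β < α := by exact_mod_cast hβα
  -- Empty families at the bad ranks make the cardinality bound hold for every `n`; the good ranks
  -- recur infinitely often.
  let W (n : ℕ) : Finset (Fin n → Fin 2) := if (freeCount p n : ℝ) ≤ n * β then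
    Finset.univ.filter fun w : Fin n → Fin 2 => ∀ k : Fin n, 0 < p (w k) k else ∅
  refine billingsleyDim_le hα0 (billingsleyMeasure_eq_zero hq hα0 hβα W (fun n => ?_)
    fun x hx => ?_)
  · by_cases h : (freeCount p n : ℝ) ≤ n * β
    · simp only [W, if_pos h]
      calc _ ≤ ((2 ^ freeCount p n : ℕ) : ℝ≥0∞) := by
            exact_mod_cast card_admissible_le p n
        _ = 2 ^ (freeCount p n : ℝ) := by rw [ENNReal.rpow_natCast]; push_cast; rfl
        _ ≤ 2 ^ ((n : ℝ) * β) := ENNReal.rpow_le_rpow_of_exponent_le one_le_two h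
    · simp [W, if_neg h]
  · refine ((frequently_lt_of_liminf_lt (h := hβ)).and_eventually
      (eventually_gt_atTop 0)).mono fun n ⟨hn, hn0⟩ => ?_
    have hn0' : (0 : ℝ) < n := by exact_mod_cast hn0
    have h1 : freeCount p n / (n : ℝ) < β := by exact_mod_cast hn
    rw [div_lt_iff₀ hn0', mul_comm] at h1
    simp only [W, if_pos h1.le]
    simpa only [Set.mem_iUnion, exists_prop] using support_subset_iUnion_hull hq hmeas hp n hx

end Digits

end Ostrogradsky

theorem mainTheorem6 {Ω : Type*} [MeasurableSpace Ω] (P : Measure Ω) [IsProbabilityMeasure P]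
    (q : ℕ → ℕ) (hq : Ostrogradsky.IsSecondOstrogradsky q)
    (ξ : ℕ → Ω → Fin 2) (hmeas : ∀ k, Measurable (ξ k)) (hindep : iIndepFun ξ P)
    (p : Fin 2 → ℕ → ℝ) (hp : ∀ i k, P.real {ω | ξ k ω = i} = p i k) :
    Ostrogradsky.billingsleyDimMeasure
        (Ostrogradsky.seriesLaw P q ξ) (Ostrogradsky.uniformLaw q) =
      liminf (fun n : ℕ =>
        ((Ostrogradsky.entropySum p n / ((n : ℝ) * Real.log 2) : ℝ) : EReal)) atTop ∧
    Ostrogradsky.billingsleyDim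
        (Ostrogradsky.seriesLaw P q ξ).support (Ostrogradsky.uniformLaw q) =
      liminf (fun k : ℕ =>
        (((Ostrogradsky.freeCount p k : ℝ) / (k : ℝ) : ℝ) : EReal)) atTop :=
  ⟨Ostrogradsky.billingsleyDimMeasure_eq hq hmeas hindep hp,
    le_antisymm (Ostrogradsky.billingsleyDim_support_le hq hmeas hp)
      (Ostrogradsky.le_billingsleyDim_support hq hmeas hindep hp)⟩
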